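/- A polyhedron is an intersection of finitely many closed half-spaces of some $\mathbb{R}^m$, and a polytope is a bounded polyhedron; a $d$-polytope is a nonempty polytope whose affine hull has dimension $d$. The nonempty faces of a polytope $P$ are $P$ itself and its intersections with supporting hyperplanes; the faces of dimension $0$, $1$ and $d-1$ of a $d$-polytope are its vertices, edges and facets. The graph $G(P)$ has the vertices of $P$ as its nodes, two distinct vertices being adjacent when they lie in a common $1$-face of $P$, and the diameter of $G(P)$ is the largest graph distance between two of its nodes. Let $H(n,d)$ denote the maximum diameter of $G(P)$ over all $d$-polytopes $P$ with exactly $n$ facets (with the convention that $H(n,d)=0$ if there is no such polytope, which for $n>d\ge 1$ happens only when $d=1$ and $n\geq 3$). **Theorem (Klee–Walkup).** For all integers $d\ge 1$ and $k\ge 1$, $$H(d+k,d)\le H(2k,k),$$ with equality if $k<d$. The condition $k<d$ is not necessary for equality: there are $d,k\ge 1$ with $k\ge d$ and $H(d+k,d)=H(2k,k)$. -/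

import Mathlib

namespace PolytopeDiameter

section General

variable {E : Type*} [NormedAddCommGroup E] [NormedSpace ℝ E]

/-- A polyhedron: the intersection of finitely many closed half-spaces `{x | a x ≤ b}`. -/
def IsPolyhedron (P : Set E) : Prop :=
  ∃ s : Finset (StrongDual ℝ E × ℝ), P = {x | ∀ h ∈ s, h.1 x ≤ h.2}

/-- A polytope: a bounded polyhedron. -/
def IsPolytope (P : Set E) : Prop :=
  IsPolyhedron P ∧ Bornology.IsBounded P

/-- `P` is a nonempty set whose affine hull has dimension `i`. -/
def HasDim (P : Set E) (i : ℕ) : Prop :=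
  P.Nonempty ∧ Module.finrank ℝ (affineSpan ℝ P).direction = i

/-- `F` is an `i`-face of `P`. A nonempty set is exposed exactly if it is the set of all points
of `P` at which some linear functional is maximal on `P`, that is, the intersection of `P` with
the boundary of a closed half-space containing `P`. The zero functional is allowed, so `P` is a
face of itself. -/
def IsFaceOfDim (P : Set E) (i : ℕ) (F : Set E) : Prop :=
  IsExposed ℝ P F ∧ HasDim F i

/-- The facets of a `d`-dimensional `P`: its faces of dimension `d - 1`. -/
def facets (P : Set E) (d : ℕ) : Set (Set E) :=
  {F | ∃ i, i + 1 = d ∧ IsFaceOfDim P i F}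

/-- The vertices of `P`: the points whose singletons are the `0`-faces. -/
def vertices (P : Set E) : Set E :=
  {x | IsFaceOfDim P 0 {x}}

/-- The graph of `P`: two distinct vertices are adjacent if some `1`-face contains both. -/
def graph (P : Set E) : SimpleGraph (vertices P) where
  Adj u v := u ≠ v ∧ ∃ F, IsFaceOfDim P 1 F ∧ (u : E) ∈ F ∧ (v : E) ∈ F
  symm := ⟨fun _ _ ⟨hne, F, hF, hu, hv⟩ => ⟨hne.symm, F, hF, hv, hu⟩⟩
  loopless := ⟨fun _ h => h.1 rfl⟩

end General

/-- The set of diameters of graphs of `d`-polytopes with `n` facets, where the polytopes may lie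
in a Euclidean space of any dimension. -/
def diameters (n d : ℕ) : Set ℕ∞ :=
  {δ | ∃ (m : ℕ) (P : Set (EuclideanSpace ℝ (Fin m))),
    IsPolytope P ∧ HasDim P d ∧ (facets P d).encard = n ∧ δ = (graph P).ediam}

/-- `H n d`: the largest diameter of the graph of a `d`-polytope with `n` facets. -/
noncomputable def H (n d : ℕ) : ℕ∞ :=
  sSup (diameters n d)

end PolytopeDiameter

/-!
The proof compares polytopes in three ways.

* *Wedges* (`H_le_wedge`): the wedge over a facet of a `d`-polytope with `n` facets is a
  `(d + 1)`-polytope with `n + 1` facets. Its faces project onto faces of the base of no larger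
  dimension, so every walk in its graph projects to a walk in the base that is at most as long, and
  distances do not shrink when passing to the wedge. Hence `H (d + k) d` is monotone in `d`
  for fixed `k ≥ 1`.
* *Prisms* (`H_le_prism`): in the same way `H n d ≤ H (n + 2) (d + 1)`, so `H (2 * k) k` is monotone
  in `k`. Wedges and prisms are treated together as bands `{(x, t) | x ∈ P, 0 ≤ t ≤ b - a x}`.
* *Facets* (`H_succ_le`): a vertex of a `d`-polytope lies in at least `d` facets, so if `n < 2 * d`
  any two vertices lie in a common facet. Its graph is a subgraph of that of the polytope,
  and it has at least `d` and at most `n - 1` facets of its own.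

For `d ≤ k` the inequality follows from wedges. For `k < d` it follows by induction on `d`: a common
facet has `(d - 1) + j` facets with `1 ≤ j ≤ k`, and prisms compare `H (2 * j) j` with `H (2 * k) k`.
This use of prisms makes it unnecessary to show that `H n d` is monotone in `n`. The reverse
inequality for `k < d` is again the one for wedges.

The facet step needs the correspondence between facets and the inequalities of an irredundant
description (`IrredundantlyDescribes.encard_facets`), and the fact that the nonempty exposed faces of
a polyhedron are the nonempty sets on which some of its inequalities are tight
(`Describes.isExposed_tight`, `Describes.exists_eq_tight`).
-/

namespace PolytopeDiameter

/-! ### Dimension, exposed faces and graph distance -/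

section Basic

variable {E E' : Type*} [NormedAddCommGroup E] [NormedSpace ℝ E]
  [NormedAddCommGroup E'] [NormedSpace ℝ E']

theorem hasDim_iff {P : Set E} {i : ℕ} :
    HasDim P i ↔ P.Nonempty ∧ Module.finrank ℝ (vectorSpan ℝ P) = i := by
  rw [HasDim, direction_affineSpan]

theorem hasDim_singleton (x : E) : HasDim {x} 0 := by
  simp [hasDim_iff]

theorem HasDim.image {P : Set E} {i : ℕ} (h : HasDim P i) {f : E →ᵃ[ℝ] E'}
    (hf : Function.Injective f) : HasDim (f '' P) i := by
  refine ⟨h.1.image f, ?_⟩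
  have hl : Function.Injective f.linear := f.linear_injective_iff.2 hf
  rw [← AffineSubspace.map_span, AffineSubspace.map_direction,
    ← (Submodule.equivMapOfInjective f.linear hl _).finrank_eq]
  exact h.2

theorem HasDim.mono [FiniteDimensional ℝ E] {A B : Set E} {i j : ℕ} (hA : HasDim A i)
    (hB : HasDim B j) (hAB : A ⊆ B) : i ≤ j := by
  rw [hasDim_iff] at hA hB
  rw [← hA.2, ← hB.2]
  exact Submodule.finrank_mono (vectorSpan_mono ℝ hAB)

theorem HasDim.unique {A : Set E} {i j : ℕ} (hi : HasDim A i) (hj : HasDim A j) : i = j :=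
  hi.2.symm.trans hj.2

theorem HasDim.subsingleton [FiniteDimensional ℝ E] {A : Set E} (h : HasDim A 0) :
    A.Subsingleton := by
  rw [hasDim_iff, Submodule.finrank_eq_zero] at h
  exact (vectorSpan_eq_bot_iff_subsingleton ℝ).1 h.2

theorem isFaceOfDim_iff {P F : Set E} {i : ℕ} :
    IsFaceOfDim P i F ↔ (∃ l : StrongDual ℝ E, F = l.toExposed P) ∧ HasDim F i :=
  ⟨fun h => ⟨h.1 h.2.1, h.2⟩, fun h => ⟨fun _ => h.1, h.2⟩⟩

theorem mem_facets_succ {P F : Set E} {i : ℕ} : F ∈ facets P (i + 1) ↔ IsFaceOfDim P i F := by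
  simp [facets]

/-- A functional that is maximal on `P` exactly along `A` is constant on the affine hull of `A`,
so it cannot separate `A` from a larger set with the same affine hull. -/
theorem eq_of_isExposed_of_subset [FiniteDimensional ℝ E] {P A B : Set E} {i : ℕ}
    (hA : IsExposed ℝ P A) (hAi : HasDim A i) (hBi : HasDim B i) (hAB : A ⊆ B) (hBP : B ⊆ P) :
    A = B := by
  refine hAB.antisymm fun x hx => ?_
  obtain ⟨y, hy⟩ := hAi.1
  obtain ⟨l, rfl⟩ := hA ⟨y, hy⟩
  rw [hasDim_iff] at hAi hBi
  have hspan := Submodule.eq_of_le_of_finrank_eq (vectorSpan_mono ℝ hAB) (hAi.2.trans hBi.2.symm)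
  have hle : vectorSpan ℝ {x ∈ P | ∀ y ∈ P, l y ≤ l x} ≤ LinearMap.ker l.toLinearMap := by
    rw [vectorSpan_def, Submodule.span_le]
    rintro _ ⟨p, hp, q, hq, rfl⟩
    simp only [SetLike.mem_coe, LinearMap.mem_ker, ContinuousLinearMap.coe_coe, vsub_eq_sub,
      map_sub, sub_eq_zero]
    exact le_antisymm (hq.2 p hp.1) (hp.2 q hq.1)
  have hxy : x - y ∈ vectorSpan ℝ B := vsub_mem_vectorSpan ℝ hx (hAB hy)
  rw [← hspan] at hxy
  have := hle hxy
  simp only [LinearMap.mem_ker, ContinuousLinearMap.coe_coe, map_sub, sub_eq_zero] at this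
  exact ⟨hBP hx, fun z hz => this ▸ hy.2 z hz⟩

/-- A map of vertex sets that contracts some edges and preserves the others does not increase
distances. -/
theorem edist_map_le {α β : Type*} {G : SimpleGraph α} {G' : SimpleGraph β} (f : α → β)
    (hf : ∀ u v, G.Adj u v → f u = f v ∨ G'.Adj (f u) (f v)) (u v : α) :
    G'.edist (f u) (f v) ≤ G.edist u v := by
  refine le_iInf fun p => ?_
  induction p with
  | nil => simp
  | @cons u v w h p ih =>
    refine SimpleGraph.edist_triangle (v := f v) |>.trans ?_
    rw [SimpleGraph.Walk.length_cons, Nat.cast_add, add_comm (p.length : ℕ∞)]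
    refine add_le_add ?_ ih
    rcases hf u v h with h | h
    · simp [h]
    · exact (SimpleGraph.edist_eq_one_iff_adj.2 h).le

end Basic

/-! ### Independence of the ambient space -/

section Transfer

variable {E E' : Type*} [NormedAddCommGroup E] [NormedSpace ℝ E]
  [NormedAddCommGroup E'] [NormedSpace ℝ E'] (e : E ≃L[ℝ] E')

theorem HasDim.image_equiv {P : Set E} {i : ℕ} (h : HasDim P i) : HasDim (e '' P) i :=
  h.image (f := e.toLinearEquiv.toLinearMap.toAffineMap) e.injective

theorem IsFaceOfDim.image_equiv {P F : Set E} {i : ℕ} (h : IsFaceOfDim P i F) :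
    IsFaceOfDim (e '' P) i (e '' F) := by
  rw [isFaceOfDim_iff] at h ⊢
  obtain ⟨⟨l, rfl⟩, hd⟩ := h
  refine ⟨⟨l.comp (e.symm : E' →L[ℝ] E), ?_⟩, hd.image_equiv e⟩
  ext x
  obtain ⟨x, rfl⟩ := e.surjective x
  simp [ContinuousLinearMap.toExposed]

theorem isFaceOfDim_image_equiv {P F : Set E} {i : ℕ} :
    IsFaceOfDim (e '' P) i (e '' F) ↔ IsFaceOfDim P i F := by
  refine ⟨fun h => ?_, fun h => h.image_equiv e⟩
  simpa [Set.image_image] using h.image_equiv e.symm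

theorem IsPolytope.image_equiv {P : Set E} (h : IsPolytope P) : IsPolytope (e '' P) := by
  classical
  obtain ⟨⟨s, rfl⟩, hb⟩ := h
  refine ⟨⟨s.image fun h => (h.1.comp (e.symm : E' →L[ℝ] E), h.2), ?_⟩,
    (e : E →L[ℝ] E').lipschitz.isBounded_image hb⟩
  ext x
  obtain ⟨x, rfl⟩ := e.surjective x
  simp only [e.injective.mem_set_image, Set.mem_ofPred_eq, Finset.forall_mem_image]
  simp

theorem facets_image_equiv (P : Set E) (d : ℕ) :
    facets (e '' P) d = (fun F => e '' F) '' facets P d := by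
  ext F
  constructor
  · rintro ⟨i, hi, hF⟩
    refine ⟨e.symm '' F, ⟨i, hi, ?_⟩, by simp [Set.image_image]⟩
    rw [← isFaceOfDim_image_equiv e]
    simpa [Set.image_image] using hF
  · rintro ⟨F, ⟨i, hi, hF⟩, rfl⟩
    exact ⟨i, hi, hF.image_equiv e⟩

theorem encard_facets_image_equiv (P : Set E) (d : ℕ) :
    (facets (e '' P) d).encard = (facets P d).encard := by
  rw [facets_image_equiv]
  exact (Set.image_injective.2 e.injective).encard_image _

theorem mem_vertices_image_equiv {P : Set E} {x : E} :
    e x ∈ vertices (e '' P) ↔ x ∈ vertices P := by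
  have := isFaceOfDim_image_equiv e (P := P) (F := {x}) (i := 0)
  rwa [Set.image_singleton] at this

theorem edist_le_edist_image_equiv {P : Set E} (u v : vertices P) :
    (graph P).edist u v ≤
      (graph (e '' P)).edist ⟨e u, (mem_vertices_image_equiv e).2 u.2⟩
        ⟨e v, (mem_vertices_image_equiv e).2 v.2⟩ := by
  have hf (w : vertices (e '' P)) : e.symm w ∈ vertices P := by
    rw [← mem_vertices_image_equiv e]
    simp
  have := edist_map_le (G := graph (e '' P)) (G' := graph P) (fun w => ⟨e.symm w, hf w⟩) ?_
    ⟨e u, (mem_vertices_image_equiv e).2 u.2⟩ ⟨e v, (mem_vertices_image_equiv e).2 v.2⟩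
  · simpa using this
  rintro a b ⟨hne, F, hF, ha, hb⟩
  refine .inr ⟨fun h => hne ?_, e.symm '' F, ?_, ⟨a, ha, rfl⟩, ⟨b, hb, rfl⟩⟩
  · simpa [Subtype.ext_iff] using h
  · rw [← isFaceOfDim_image_equiv e]
    simpa [Set.image_image] using hF

theorem edist_le_H [FiniteDimensional ℝ E] {P : Set E} {n d : ℕ} (hP : IsPolytope P)
    (hd : HasDim P d) (hn : (facets P d).encard = n) (u v : vertices P) :
    (graph P).edist u v ≤ H n d := by
  have e : E ≃L[ℝ] EuclideanSpace ℝ (Fin (Module.finrank ℝ E)) :=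
    ContinuousLinearEquiv.ofFinrankEq (by simp)
  refine (edist_le_edist_image_equiv e u v).trans (SimpleGraph.edist_le_ediam.trans ?_)
  exact le_sSup ⟨_, e '' P, hP.image_equiv e, hd.image_equiv e,
    by rw [encard_facets_image_equiv, hn], rfl⟩

theorem H_le {n d : ℕ} {b : ℕ∞}
    (h : ∀ (m : ℕ) (P : Set (EuclideanSpace ℝ (Fin m))), IsPolytope P → HasDim P d →
      (facets P d).encard = n → ∀ u v : vertices P, (graph P).edist u v ≤ b) : H n d ≤ b := by
  refine sSup_le ?_
  rintro _ ⟨m, P, hP, hd, hn, rfl⟩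
  exact SimpleGraph.ediam_le_of_edist_le (h m P hP hd hn)

end Transfer

/-! ### Wedges and prisms -/

section Band

variable {E : Type*} [NormedAddCommGroup E] [NormedSpace ℝ E]

/-- The region of `E × ℝ` over `P` between height `0` and the height given by the affine function
`x ↦ b - a x`. It is a prism over `P` if `a = 0` and `b = 1`, and the wedge over a face `F` of `P`
if the height is nonnegative on `P` and vanishes exactly on `F`. -/
def band (P : Set E) (a : StrongDual ℝ E) (b : ℝ) : Set (E × ℝ) :=
  {p | p.1 ∈ P ∧ 0 ≤ p.2 ∧ p.2 ≤ b - a p.1}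

/-- The embedding of `E` into `E × ℝ` as the graph of the affine function `x ↦ b - a x`. -/
noncomputable def lift (a : StrongDual ℝ E) (b : ℝ) : E →ᵃ[ℝ] E × ℝ :=
  (AffineMap.id ℝ E).prod (AffineMap.const ℝ E b - a.toLinearMap.toAffineMap)

@[simp]
theorem lift_apply (a : StrongDual ℝ E) (b : ℝ) (x : E) : lift a b x = (x, b - a x) := rfl

theorem lift_injective (a : StrongDual ℝ E) (b : ℝ) : Function.Injective (lift a b) :=
  fun _ _ h => congrArg Prod.fst h

/-- The part of the band that lies over `K`. -/
def wall (P : Set E) (a : StrongDual ℝ E) (b : ℝ) (K : Set E) : Set (E × ℝ) :=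
  {p ∈ band P a b | p.1 ∈ K}

variable {P : Set E} {a : StrongDual ℝ E} {b : ℝ}

theorem isPolytope_band (hP : IsPolytope P) : IsPolytope (band P a b) := by
  classical
  obtain ⟨⟨s, hs⟩, hbd⟩ := hP
  let fst : E × ℝ →L[ℝ] E := ContinuousLinearMap.fst ℝ E ℝ
  let snd : E × ℝ →L[ℝ] ℝ := ContinuousLinearMap.snd ℝ E ℝ
  constructor
  · refine ⟨s.image (fun h => (h.1.comp fst, h.2)) ∪ {(-snd, 0), (snd + a.comp fst, b)}, ?_⟩
    ext ⟨x, t⟩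
    simp only [band, hs, Set.mem_ofPred_eq, Finset.mem_union, Finset.mem_image, Finset.mem_insert,
      Finset.mem_singleton, or_imp, forall_and, forall_exists_index, and_imp,
      forall_apply_eq_imp_iff₂, forall_eq]
    simp [fst, snd, le_sub_iff_add_le]
  · obtain ⟨R, hR⟩ := (a.lipschitz.isBounded_image hbd).exists_norm_le
    refine (hbd.prod (Metric.isBounded_Icc 0 (b + R))).subset ?_
    rintro ⟨x, t⟩ ⟨hx, h0, h1⟩
    have := (abs_le.1 (hR _ ⟨x, hx, rfl⟩)).1
    exact ⟨hx, h0, by simp only at h1; linarith⟩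

theorem mem_band_zero (hb : ∀ x ∈ P, a x ≤ b) {x : E} (hx : x ∈ P) : (x, (0 : ℝ)) ∈ band P a b :=
  ⟨hx, le_rfl, sub_nonneg.2 (hb x hx)⟩

theorem mem_band_top (hb : ∀ x ∈ P, a x ≤ b) {x : E} (hx : x ∈ P) : (x, b - a x) ∈ band P a b :=
  ⟨hx, sub_nonneg.2 (hb x hx), le_rfl⟩

theorem isExposed_bottom (hb : ∀ x ∈ P, a x ≤ b) {K : Set E} (hK : IsExposed ℝ P K) :
    IsExposed ℝ (band P a b) (lift 0 0 '' K) := by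
  intro hne
  obtain ⟨l, rfl⟩ := hK hne.of_image
  refine ⟨l.comp (ContinuousLinearMap.fst ℝ E ℝ) - ContinuousLinearMap.snd ℝ E ℝ, ?_⟩
  ext ⟨x, t⟩
  constructor
  · rintro ⟨x, ⟨hx, hmax⟩, h⟩
    obtain ⟨rfl, rfl⟩ := Prod.mk.inj h
    refine ⟨by simpa using mem_band_zero hb hx, ?_⟩
    rintro ⟨y, r⟩ ⟨hy, hr, -⟩
    have := hmax y hy
    simp only at hr
    simp
    linarith
  · rintro ⟨⟨hx, ht, -⟩, hmax⟩
    have h0 := hmax _ (mem_band_zero hb hx)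
    simp only [sub_apply, ContinuousLinearMap.comp_apply,
      ContinuousLinearMap.coe_fst', ContinuousLinearMap.coe_snd'] at h0 ht
    obtain rfl : t = 0 := by linarith
    refine ⟨x, ⟨hx, fun y hy => ?_⟩, by simp⟩
    simpa using hmax _ (mem_band_zero hb hy)

theorem isExposed_top (hb : ∀ x ∈ P, a x ≤ b) {K : Set E} (hK : IsExposed ℝ P K) :
    IsExposed ℝ (band P a b) (lift a b '' K) := by
  intro hne
  obtain ⟨l, rfl⟩ := hK hne.of_image
  refine ⟨(l + a).comp (ContinuousLinearMap.fst ℝ E ℝ) + ContinuousLinearMap.snd ℝ E ℝ, ?_⟩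
  ext ⟨x, t⟩
  constructor
  · rintro ⟨x, ⟨hx, hmax⟩, h⟩
    obtain ⟨rfl, rfl⟩ := Prod.mk.inj h
    refine ⟨mem_band_top hb hx, ?_⟩
    rintro ⟨y, r⟩ ⟨hy, -, hr⟩
    have := hmax y hy
    simp only at hr
    simp
    linarith
  · rintro ⟨⟨hx, -, ht⟩, hmax⟩
    have h0 := hmax _ (mem_band_top hb hx)
    simp only [add_apply, ContinuousLinearMap.comp_apply,
      ContinuousLinearMap.coe_fst', ContinuousLinearMap.coe_snd'] at h0 ht
    obtain rfl : t = b - a x := by linarith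
    refine ⟨x, ⟨hx, fun y hy => ?_⟩, by simp⟩
    have := hmax _ (mem_band_top hb hy)
    simp at this
    linarith

theorem isExposed_wall (hb : ∀ x ∈ P, a x ≤ b) {K : Set E} (hK : IsExposed ℝ P K) :
    IsExposed ℝ (band P a b) (wall P a b K) := by
  rintro ⟨p, hp⟩
  obtain ⟨l, rfl⟩ := hK ⟨p.1, hp.2⟩
  refine ⟨l.comp (ContinuousLinearMap.fst ℝ E ℝ), ?_⟩
  ext ⟨x, t⟩
  refine and_congr_right fun hx => ⟨fun h q hq => h.2 _ hq.1, fun h => ⟨hx.1, fun y hy => ?_⟩⟩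
  simpa using h _ (mem_band_zero hb hy)

/-- A face of a band is cut out by a functional `c x + γ t`, and it is the graph of the upper or
the lower boundary over a face of `P`, or the part of the band over a face of `P`, according to the
sign of `γ`. -/
theorem exists_face_of_isExposed_band (hb : ∀ x ∈ P, a x ≤ b) {G : Set (E × ℝ)}
    (hG : IsExposed ℝ (band P a b) G) (hne : G.Nonempty) :
    ∃ K, IsExposed ℝ P K ∧ K.Nonempty ∧
      (G = lift a b '' K ∨ G = lift 0 0 '' K ∨ G = wall P a b K) := by
  obtain ⟨L, rfl⟩ := hG hne
  obtain ⟨⟨x₀, t₀⟩, h₀⟩ := hne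
  let c : StrongDual ℝ E := L.comp (ContinuousLinearMap.inl ℝ E ℝ)
  let γ : ℝ := L (0, 1)
  have hL (x : E) (t : ℝ) : L (x, t) = c x + γ * t := by
    have : ((x, t) : E × ℝ) = (x, 0) + t • (0, 1) := by simp
    rw [this, map_add, map_smul, smul_eq_mul, mul_comm]
    rfl
  have hL' : ∀ p : E × ℝ, L p = c p.1 + γ * p.2 := fun p => hL p.1 p.2
  rcases lt_trichotomy γ 0 with hγ | hγ | hγ
  · have key : {x ∈ band P a b | ∀ y ∈ band P a b, L y ≤ L x} = lift 0 0 '' c.toExposed P := by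
      ext ⟨x, t⟩
      constructor
      · rintro ⟨hx, hmax⟩
        have h0 := hmax _ (mem_band_zero hb hx.1)
        have ht : 0 ≤ t := hx.2.1
        rw [hL, hL] at h0
        obtain rfl : t = 0 := by nlinarith
        refine ⟨x, ⟨hx.1, fun y hy => ?_⟩, by simp⟩
        simpa [hL] using hmax _ (mem_band_zero hb hy)
      · rintro ⟨x, ⟨hx, hmax⟩, h⟩
        obtain ⟨rfl, rfl⟩ := Prod.mk.inj h
        refine ⟨by simpa using mem_band_zero hb hx, ?_⟩
        rintro ⟨y, r⟩ ⟨hy, hr, -⟩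
        have := hmax y hy
        simp only at hr
        simp only [hL]
        simp
        nlinarith
    rw [key] at h₀ ⊢
    exact ⟨_, ContinuousLinearMap.toExposed.isExposed, Set.Nonempty.of_image ⟨_, h₀⟩,
      .inr (.inl rfl)⟩
  · have key : {x ∈ band P a b | ∀ y ∈ band P a b, L y ≤ L x} = wall P a b (c.toExposed P) := by
      ext ⟨x, t⟩
      refine and_congr_right fun hx => ⟨fun h => ⟨hx.1, fun y hy => ?_⟩, fun h q hq => ?_⟩
      · simpa [hL, hγ] using h _ (mem_band_zero hb hy)
      · simpa [hL', hγ] using h.2 _ hq.1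
    rw [key] at h₀ ⊢
    exact ⟨_, ContinuousLinearMap.toExposed.isExposed, ⟨_, h₀.2⟩, .inr (.inr rfl)⟩
  · have key : {x ∈ band P a b | ∀ y ∈ band P a b, L y ≤ L x} =
        lift a b '' (c - γ • a).toExposed P := by
      ext ⟨x, t⟩
      constructor
      · rintro ⟨hx, hmax⟩
        have h0 := hmax _ (mem_band_top hb hx.1)
        have ht : t ≤ b - a x := hx.2.2
        rw [hL, hL] at h0
        obtain rfl : t = b - a x := by nlinarith
        refine ⟨x, ⟨hx.1, fun y hy => ?_⟩, by simp⟩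
        have := hmax _ (mem_band_top hb hy)
        simp only [hL] at this
        simp
        linarith
      · rintro ⟨x, ⟨hx, hmax⟩, h⟩
        obtain ⟨rfl, rfl⟩ := Prod.mk.inj h
        refine ⟨mem_band_top hb hx, ?_⟩
        rintro ⟨y, r⟩ ⟨hy, -, hr⟩
        have := hmax y hy
        simp only at hr
        simp only [hL]
        simp at this ⊢
        nlinarith
    rw [key] at h₀ ⊢
    exact ⟨_, ContinuousLinearMap.toExposed.isExposed, Set.Nonempty.of_image ⟨_, h₀⟩, .inl rfl⟩

theorem wall_eq_image {K : Set E} (hK : K ⊆ P) (h : ∀ x ∈ K, a x = b) :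
    wall P a b K = lift a b '' K := by
  ext ⟨x, t⟩
  constructor
  · rintro ⟨⟨_, h0, h1⟩, hx⟩
    have := h x hx
    simp only at h0 h1
    refine ⟨x, hx, ?_⟩
    simp
    linarith
  · rintro ⟨x, hx, h'⟩
    obtain ⟨rfl, rfl⟩ := Prod.mk.inj h'
    exact ⟨mem_band_top (P := K) (fun y hy => (h y hy).le) hx |>.imp (fun h => hK h) id, hx⟩

theorem hasDim_wall [FiniteDimensional ℝ E] (hb : ∀ x ∈ P, a x ≤ b) {K : Set E} (hK : K ⊆ P)
    (h : ∃ x ∈ K, a x ≠ b) {i : ℕ} (hi : HasDim K i) : HasDim (wall P a b K) (i + 1) := by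
  obtain ⟨x, hx, hxb⟩ := h
  have hz {y : E} (hy : y ∈ K) : (y, (0 : ℝ)) ∈ wall P a b K := ⟨mem_band_zero hb (hK hy), hy⟩
  rw [hasDim_iff] at hi ⊢
  refine ⟨⟨_, hz hx⟩, ?_⟩
  have key : vectorSpan ℝ (wall P a b K) = (vectorSpan ℝ K).prod (⊤ : Submodule ℝ ℝ) := by
    apply le_antisymm
    · rw [vectorSpan_def, Submodule.span_le]
      rintro _ ⟨p, hp, q, hq, rfl⟩
      exact ⟨vsub_mem_vectorSpan ℝ hp.2 hq.2, trivial⟩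
    · rintro ⟨y, t⟩ ⟨hy, -⟩
      have h1 : (0, b - a x) ∈ vectorSpan ℝ (wall P a b K) := by
        have : (x, b - a x) ∈ wall P a b K := ⟨mem_band_top hb (hK hx), hx⟩
        simpa using vsub_mem_vectorSpan ℝ this (hz hx)
      have h2 : vectorSpan ℝ K ≤
          (vectorSpan ℝ (wall P a b K)).comap (LinearMap.inl ℝ E ℝ) := by
        rw [vectorSpan_def, Submodule.span_le]
        rintro _ ⟨p, hp, q, hq, rfl⟩
        simpa using vsub_mem_vectorSpan ℝ (hz hp) (hz hq)
      have hne : b - a x ≠ 0 := sub_ne_zero.2 hxb.symm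
      have h3 : (y, (0 : ℝ)) ∈ vectorSpan ℝ (wall P a b K) := h2 hy
      have := add_mem h3 (Submodule.smul_mem _ (t / (b - a x)) h1)
      simpa [hne] using this
  have hrange : (vectorSpan ℝ K).prod (⊤ : Submodule ℝ ℝ) =
      LinearMap.range ((vectorSpan ℝ K).subtype.prodMap (LinearMap.id (R := ℝ) (M := ℝ))) := by
    simp [LinearMap.range_prodMap]
  rw [key, hrange, LinearMap.finrank_range_of_inj, Module.finrank_prod, hi.2, Module.finrank_self]
  exact Subtype.val_injective.prodMap Function.injective_id

theorem hasDim_of_nonempty {K : Set E} (hK : K.Nonempty) : ∃ i, HasDim K i := ⟨_, hK, rfl⟩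

theorem IsFaceOfDim.of_band [FiniteDimensional ℝ E] (hb : ∀ x ∈ P, a x ≤ b) {G : Set (E × ℝ)}
    {i : ℕ} (hG : IsFaceOfDim (band P a b) i G) :
    ∃ K, (IsFaceOfDim P i K ∧ (G = lift a b '' K ∨ G = lift 0 0 '' K)) ∨
      ∃ j, j + 1 = i ∧ IsFaceOfDim P j K ∧ (∃ x ∈ K, a x ≠ b) ∧ G = wall P a b K := by
  obtain ⟨K, hK, hne, h⟩ := exists_face_of_isExposed_band hb hG.1 hG.2.1
  obtain ⟨j, hj⟩ := hasDim_of_nonempty hne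
  refine ⟨K, ?_⟩
  have hl {c : StrongDual ℝ E} {β : ℝ} (h : G = lift c β '' K) : IsFaceOfDim P i K := by
    obtain rfl := (hj.image (lift_injective c β)).unique (h ▸ hG.2)
    exact ⟨hK, hj⟩
  rcases h with h | h | h
  · exact .inl ⟨hl h, .inl h⟩
  · exact .inl ⟨hl h, .inr h⟩
  · by_cases hx : ∃ x ∈ K, a x ≠ b
    · exact .inr ⟨j, (hasDim_wall hb hK.subset hx hj).unique (h ▸ hG.2), ⟨hK, hj⟩, hx, h⟩
    · push Not at hx
      rw [wall_eq_image hK.subset hx] at h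
      exact .inl ⟨hl h, .inl h⟩

/-- The projection of a face of a band is a face of the base of no larger dimension. -/
theorem IsFaceOfDim.exists_projection [FiniteDimensional ℝ E] (hb : ∀ x ∈ P, a x ≤ b)
    {G : Set (E × ℝ)} {i : ℕ} (hG : IsFaceOfDim (band P a b) i G) :
    ∃ j ≤ i, IsFaceOfDim P j (Prod.fst '' G) := by
  have hl (c : StrongDual ℝ E) (β : ℝ) (K : Set E) : Prod.fst '' (lift c β '' K) = K := by
    simp [Set.image_image]
  obtain ⟨K, ⟨hK, rfl | rfl⟩ | ⟨j, rfl, hK, -, rfl⟩⟩ := hG.of_band hb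
  · exact ⟨i, le_rfl, by rwa [hl]⟩
  · exact ⟨i, le_rfl, by rwa [hl]⟩
  · refine ⟨j, Nat.le_succ j, ?_⟩
    convert hK
    ext x
    exact ⟨fun ⟨p, hp, h⟩ => h ▸ hp.2, fun hx => ⟨_, ⟨mem_band_zero hb (hK.1.subset hx), hx⟩, rfl⟩⟩

theorem hasDim_band [FiniteDimensional ℝ E] (hb : ∀ x ∈ P, a x ≤ b) (h : ∃ x ∈ P, a x ≠ b) {d : ℕ}
    (hd : HasDim P d) : HasDim (band P a b) (d + 1) := by
  have : band P a b = wall P a b P := by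
    ext p
    exact ⟨fun hp => ⟨hp, hp.1⟩, fun hp => hp.1⟩
  rw [this]
  exact hasDim_wall hb subset_rfl h hd

theorem facets_band [FiniteDimensional ℝ E] (hb : ∀ x ∈ P, a x ≤ b) {d : ℕ} (hd : HasDim P d) :
    facets (band P a b) (d + 1) =
      {lift a b '' P, lift 0 0 '' P} ∪ wall P a b '' {G ∈ facets P d | ∃ x ∈ G, a x ≠ b} := by
  ext G
  rw [mem_facets_succ]
  constructor
  · intro hG
    obtain ⟨K, ⟨hK, h⟩ | ⟨j, hj, hK, hx, rfl⟩⟩ := hG.of_band hb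
    · obtain rfl := eq_of_isExposed_of_subset hK.1 hK.2 hd hK.1.subset subset_rfl
      exact .inl h
    · exact .inr ⟨K, ⟨⟨j, hj, hK⟩, hx⟩, rfl⟩
  · rintro ((rfl | rfl) | ⟨K, ⟨⟨j, rfl, hK⟩, hx⟩, rfl⟩)
    · exact ⟨isExposed_top hb (.refl P), hd.image (lift_injective _ _)⟩
    · exact ⟨isExposed_bottom hb (.refl P), hd.image (lift_injective _ _)⟩
    · exact ⟨isExposed_wall hb hK.1, hasDim_wall hb hK.1.subset hx hK.2⟩

theorem encard_facets_band [FiniteDimensional ℝ E] (hb : ∀ x ∈ P, a x ≤ b)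
    (h : ∃ x ∈ P, a x ≠ b) {d : ℕ} (hd : HasDim P d) :
    (facets (band P a b) (d + 1)).encard = {G ∈ facets P d | ∃ x ∈ G, a x ≠ b}.encard + 2 := by
  have hproj {K : Set E} (hK : K ⊆ P) : Prod.fst '' wall P a b K = K := by
    ext x
    exact ⟨fun ⟨p, hp, h⟩ => h ▸ hp.2, fun hx => ⟨_, ⟨mem_band_zero hb (hK hx), hx⟩, rfl⟩⟩
  have hsub {K : Set E} (hK : K ∈ {G ∈ facets P d | ∃ x ∈ G, a x ≠ b}) : K ⊆ P := by
    obtain ⟨⟨j, -, hK⟩, -⟩ := hK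
    exact hK.1.subset
  rw [facets_band hb hd, Set.encard_union_eq, Set.encard_pair, Set.InjOn.encard_image, add_comm]
  · intro K hK K' hK' h
    rw [← hproj (hsub hK), ← hproj (hsub hK'), h]
  · obtain ⟨x, hx, hxb⟩ := h
    intro heq
    obtain ⟨y, -, hy⟩ := heq.subset ⟨x, hx, rfl⟩
    have h2 : (0 : ℝ) - (0 : StrongDual ℝ E) y = b - a x := congrArg Prod.snd hy
    rw [zero_apply, sub_zero] at h2
    exact hxb (by linarith)
  · rw [Set.disjoint_left]
    rintro _ hG ⟨K, hK, rfl⟩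
    have : Prod.fst '' wall P a b K = P := by
      rcases hG with h | h <;> rw [h] <;> simp [Set.image_image]
    rw [hproj (hsub hK)] at this
    obtain ⟨⟨j, rfl, hK⟩, -⟩ := hK
    have := (this ▸ hK.2).unique hd
    omega

theorem edist_le_H_band [FiniteDimensional ℝ E] (hP : IsPolytope P) (hb : ∀ x ∈ P, a x ≤ b)
    (h : ∃ x ∈ P, a x ≠ b) {n d : ℕ} (hd : HasDim P d)
    (hn : {G ∈ facets P d | ∃ x ∈ G, a x ≠ b}.encard = n) (u v : vertices P) :
    (graph P).edist u v ≤ H (n + 2) (d + 1) := by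
  have hlift (w : vertices P) : ((w : E), (0 : ℝ)) ∈ vertices (band P a b) := by
    refine ⟨?_, hasDim_singleton _⟩
    simpa using isExposed_bottom hb w.2.1
  have hproj (w : vertices (band P a b)) : (w : E × ℝ).1 ∈ vertices P := by
    obtain ⟨j, hj, hw⟩ := w.2.exists_projection hb
    obtain rfl : j = 0 := by omega
    rwa [Set.image_singleton] at hw
  refine le_trans ?_ (edist_le_H (isPolytope_band hP) (hasDim_band hb h hd)
    (by rw [encard_facets_band hb h hd, hn]; rfl) ⟨_, hlift u⟩ ⟨_, hlift v⟩)
  refine edist_map_le (G' := graph P)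
    (fun w : vertices (band P a b) => ⟨(w : E × ℝ).1, hproj w⟩) ?_
    (⟨_, hlift u⟩ : vertices (band P a b)) ⟨_, hlift v⟩
  rintro w z ⟨-, F, hF, hw, hz⟩
  by_cases hwz : (w : E × ℝ).1 = (z : E × ℝ).1
  · exact .inl (Subtype.ext hwz)
  obtain ⟨j, hj, hK⟩ := hF.exists_projection hb
  -- A face with two points is not zero-dimensional.
  obtain rfl : j = 1 := by
    by_contra hj1
    obtain rfl : j = 0 := by omega
    exact hwz (hK.2.subsingleton ⟨_, hw, rfl⟩ ⟨_, hz, rfl⟩)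
  exact .inr ⟨fun h => hwz (congrArg Subtype.val h), _, hK, ⟨_, hw, rfl⟩, ⟨_, hz, rfl⟩⟩

end Band

/-- The height of the wedge over a facet `F` vanishes exactly on `F`, so `F` is the only facet with no
facet of the wedge standing over it; the two boundary graphs are the remaining facets. -/
theorem H_le_wedge {n d : ℕ} (hn : n ≠ 0) : H n d ≤ H (n + 1) (d + 1) := by
  refine H_le fun m P hP hd hcard u v => ?_
  obtain ⟨F, hF⟩ : (facets P d).Nonempty := by
    rw [← Set.encard_ne_zero, hcard]
    exact_mod_cast hn
  obtain ⟨i, rfl, hFi⟩ := hF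
  obtain ⟨y, hy⟩ := hFi.2.1
  obtain ⟨l, hl⟩ := hFi.1 ⟨y, hy⟩
  have hlt (x) (hx : x ∈ P) : l x = l y ↔ x ∈ F := by
    rw [hl] at hy ⊢
    exact ⟨fun h => ⟨hx, fun z hz => h ▸ hy.2 z hz⟩,
      fun h => le_antisymm (hy.2 x hx) (h.2 y hy.1)⟩
  have hne {G : Set (EuclideanSpace ℝ (Fin m))} (hG : G ⊆ P) :
      (∃ x ∈ G, l x ≠ l y) ↔ ¬ G ⊆ F := by
    rw [Set.not_subset]
    exact exists_congr fun x => and_congr_right fun hx => (hlt x (hG hx)).not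
  have hset : {G ∈ facets P (i + 1) | ∃ x ∈ G, l x ≠ l y} = facets P (i + 1) \ {F} := by
    ext G
    refine and_congr_right fun hG => ?_
    rw [mem_facets_succ] at hG
    rw [hne hG.1.subset, Set.mem_singleton_iff, not_iff_not]
    exact ⟨fun h => eq_of_isExposed_of_subset hG.1 hG.2 hFi.2 h hFi.1.subset, fun h => h.subset⟩
  obtain ⟨n, rfl⟩ := Nat.exists_eq_succ_of_ne_zero hn
  refine edist_le_H_band (a := l) (b := l y) (n := n) hP (fun x hx => ?_) ?_ hd ?_ u v
  · rw [hl] at hy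
    exact hy.2 x hx
  · refine (hne subset_rfl).2 fun h => ?_
    have := hd.mono hFi.2 h
    omega
  · rw [hset]
    have := Set.encard_sdiff_singleton_add_one (mem_facets_succ.2 hFi)
    rw [hcard, Nat.cast_succ] at this
    exact (ENat.add_left_injective_of_ne_top ENat.one_ne_top) this

theorem H_le_prism {n d : ℕ} : H n d ≤ H (n + 2) (d + 1) := by
  refine H_le fun m P hP hd hcard u v => ?_
  refine edist_le_H_band (a := 0) (b := 1) hP (by simp) ⟨hd.1.some, hd.1.some_mem, by simp⟩ hd ?_
    u v
  rw [← hcard]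
  congr 1
  ext G
  exact and_iff_left_of_imp fun ⟨i, _, hG⟩ => ⟨hG.2.1.some, hG.2.1.some_mem, by simp⟩

/-! ### Irredundant descriptions by inequalities -/

section Describes

open Filter Topology

variable {E : Type*} [NormedAddCommGroup E] [NormedSpace ℝ E]

/-- The inequalities in `s` describe `P` as a subset of its affine hull. -/
def Describes (s : Finset (StrongDual ℝ E × ℝ)) (P : Set E) : Prop :=
  ∀ x, x ∈ P ↔ x ∈ affineSpan ℝ P ∧ ∀ h ∈ s, h.1 x ≤ h.2

/-- The inequalities in `s` describe `P` in its affine hull, and none of them can be omitted. -/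
def IrredundantlyDescribes (s : Finset (StrongDual ℝ E × ℝ)) (P : Set E) : Prop :=
  Describes s P ∧ ∀ t, t ⊂ s → ¬ Describes t P

/-- The points of `P` at which all inequalities in `t` are equalities. -/
def tight (P : Set E) (t : Finset (StrongDual ℝ E × ℝ)) : Set E :=
  {x ∈ P | ∀ h ∈ t, h.1 x = h.2}

variable {s t : Finset (StrongDual ℝ E × ℝ)} {P : Set E}

theorem IsPolyhedron.exists_describes (hP : IsPolyhedron P) :
    ∃ s : Finset (StrongDual ℝ E × ℝ), Describes s P := by
  obtain ⟨s, hs⟩ := hP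
  refine ⟨s, fun x => ⟨fun hx => ⟨subset_affineSpan ℝ P hx, ?_⟩, fun hx => ?_⟩⟩
  · rw [hs] at hx
    exact hx
  · rw [hs]
    exact hx.2

theorem Describes.exists_irredundant (h : Describes s P) :
    ∃ t ⊆ s, IrredundantlyDescribes t P := by
  induction s using Finset.strongInduction with
  | H s ih =>
    by_cases hs : ∃ t, t ⊂ s ∧ Describes t P
    · obtain ⟨t, hts, ht⟩ := hs
      obtain ⟨r, hrt, hr⟩ := ih t hts ht
      exact ⟨r, hrt.trans hts.subset, hr⟩
    · push Not at hs
      exact ⟨s, subset_rfl, h, hs⟩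

theorem Describes.le (h : Describes s P) {x : E} (hx : x ∈ P) {f : StrongDual ℝ E × ℝ}
    (hf : f ∈ s) : f.1 x ≤ f.2 :=
  ((h x).1 hx).2 f hf

theorem Describes.convex (h : Describes s P) : Convex ℝ P := by
  have : P = (affineSpan ℝ P : Set E) ∩ {x | ∀ f ∈ s, f.1 x ≤ f.2} := Set.ext h
  rw [this]
  refine (affineSpan ℝ P).convex.inter fun x hx y hy p q hp hq hpq f hf => ?_
  have h1 := mul_le_mul_of_nonneg_left (hx f hf) hp
  have h2 := mul_le_mul_of_nonneg_left (hy f hf) hq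
  simp only [map_add, map_smul, smul_eq_mul]
  calc p * f.1 x + q * f.1 y ≤ p * f.2 + q * f.2 := add_le_add h1 h2
    _ = f.2 := by rw [← add_mul, hpq, one_mul]

/-- Finitely many affine inequalities on a convex set, each strict somewhere, are all strict at a
common point. -/
theorem exists_forall_lt {C : Set E} (hC : Convex ℝ C) (hne : C.Nonempty)
    (hle : ∀ h ∈ s, ∀ x ∈ C, h.1 x ≤ h.2) (hlt : ∀ h ∈ s, ∃ x ∈ C, h.1 x < h.2) :
    ∃ x ∈ C, ∀ h ∈ s, h.1 x < h.2 := by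
  classical
  induction s using Finset.induction_on with
  | empty => exact ⟨hne.some, hne.some_mem, by simp⟩
  | insert f s hf ih =>
    obtain ⟨x, hx, hxs⟩ := ih (fun h hh => hle h (Finset.mem_insert_of_mem hh))
      fun h hh => hlt h (Finset.mem_insert_of_mem hh)
    obtain ⟨y, hy, hyf⟩ := hlt f (Finset.mem_insert_self f s)
    refine ⟨(1 / 2 : ℝ) • x + (1 / 2 : ℝ) • y, hC hx hy (by norm_num) (by norm_num) (by norm_num),
      fun h hh => ?_⟩
    simp only [map_add, map_smul, smul_eq_mul]
    have h1 := hle h hh x hx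
    have h2 := hle h hh y hy
    rcases Finset.mem_insert.1 hh with rfl | hh
    · linarith
    · linarith [hxs h hh]

/-- A point of a described set can be moved a little in any direction of the affine hull along which
the inequalities that are tight at the point are preserved. -/
theorem Describes.exists_add_smul_mem (h : Describes s P) {w y : E} (hw : w ∈ P)
    (hy : y ∈ vectorSpan ℝ P) (hs : ∀ f ∈ s, f.1 w < f.2 ∨ f.1 y ≤ 0) :
    ∃ ε : ℝ, 0 < ε ∧ w + ε • y ∈ P := by
  have hev : ∀ᶠ ε : ℝ in 𝓝[>] 0, ∀ f ∈ s, f.1 (w + ε • y) ≤ f.2 := by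
    rw [Filter.eventually_all_finset]
    intro f hf
    rcases hs f hf with hlt | h0
    · have hc : ContinuousAt (fun ε : ℝ => f.1 (w + ε • y)) 0 := by fun_prop
      have : ∀ᶠ ε : ℝ in 𝓝 0, f.1 (w + ε • y) < f.2 :=
        hc.eventually_lt continuousAt_const (by simpa using hlt)
      exact (this.filter_mono nhdsWithin_le_nhds).mono fun _ h => h.le
    · filter_upwards [self_mem_nhdsWithin] with ε hε
      have hε : 0 < ε := hε
      have := h.le hw hf
      simp only [map_add, map_smul, smul_eq_mul]
      nlinarith
  obtain ⟨ε, hε, hpos⟩ := (hev.and self_mem_nhdsWithin).exists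
  refine ⟨ε, hpos, (h _).2 ⟨?_, hε⟩⟩
  rw [add_comm, ← vadd_eq_add]
  refine AffineSubspace.vadd_mem_of_mem_direction ?_ (subset_affineSpan ℝ P hw)
  rw [direction_affineSpan]
  exact Submodule.smul_mem _ _ hy

/-- A tight set is an exposed face: add up the functionals of its inequalities. -/
theorem Describes.isExposed_tight (h : Describes s P) (hts : t ⊆ s) :
    IsExposed ℝ P (tight P t) := by
  rintro ⟨w, hw, hwt⟩
  refine ⟨∑ f ∈ t, f.1, ?_⟩
  ext x
  refine and_congr_right fun hx => ⟨fun hxt y hy => ?_, fun hmax => ?_⟩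
  · simp only [sum_apply]
    exact Finset.sum_le_sum fun f hf => (h.le hy (hts hf)).trans (hxt f hf).ge
  · have h1 := hmax w hw
    simp only [sum_apply] at h1
    have h2 : ∀ f ∈ t, f.1 x ≤ f.1 w := fun f hf => (h.le hx (hts hf)).trans (hwt f hf).ge
    intro f hf
    rw [(Finset.sum_eq_sum_iff_of_le h2).1 (le_antisymm (Finset.sum_le_sum h2) h1) f hf, hwt f hf]

/-- Every nonempty exposed face is the tight set of the inequalities that are equalities on it: the
functional exposing the face cannot grow on the way from a point of the tight set through a
relatively interior point of the face and slightly beyond. -/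
theorem Describes.exists_eq_tight (h : Describes s P) {G : Set E} (hG : IsExposed ℝ P G)
    (hne : G.Nonempty) :
    ∃ t ⊆ s, G = tight P t ∧ ∃ w ∈ G, ∀ f ∈ s, f ∉ t → f.1 w < f.2 := by
  classical
  let t := s.filter fun f => ∀ x ∈ G, f.1 x = f.2
  obtain ⟨w, hw, hlt⟩ := exists_forall_lt (s := s \ t) (hG.convex h.convex) hne
    (fun f hf x hx => h.le (hG.subset hx) (Finset.mem_sdiff.1 hf).1) (by
      intro f hf
      rw [Finset.mem_sdiff, Finset.mem_filter, not_and] at hf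
      have := hf.2 hf.1
      push Not at this
      obtain ⟨x, hx, hne⟩ := this
      exact ⟨x, hx, (h.le (hG.subset hx) hf.1).lt_of_ne hne⟩)
  have hlt' : ∀ f ∈ s, f ∉ t → f.1 w < f.2 := fun f hf hft => hlt f (Finset.mem_sdiff.2 ⟨hf, hft⟩)
  refine ⟨t, Finset.filter_subset _ _, Set.Subset.antisymm
    (fun x hx => ⟨hG.subset hx, fun f hf => (Finset.mem_filter.1 hf).2 x hx⟩) ?_, w, hw, hlt'⟩
  rintro x ⟨hx, hxt⟩
  have hwP := hG.subset hw
  obtain ⟨ε, hε, hmem⟩ := h.exists_add_smul_mem hwP (y := w - x) (vsub_mem_vectorSpan ℝ hwP hx) (by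
    intro f hf
    by_cases hft : f ∈ t
    · right
      rw [map_sub, hxt f hft, (Finset.mem_filter.1 hft).2 w hw, sub_self]
    · exact .inl (hlt' f hf hft))
  obtain ⟨l, rfl⟩ := hG hne
  have h1 := hw.2 _ hmem
  simp only [map_add, map_smul, map_sub, smul_eq_mul] at h1
  have h2 : l w ≤ l x := by nlinarith
  exact ⟨hx, fun y hy => (hw.2 y hy).trans h2⟩

theorem eq_of_mem_affineSpan {A : Set E} {f : StrongDual ℝ E × ℝ} (hA : ∀ x ∈ A, f.1 x = f.2)
    {x : E} (hx : x ∈ affineSpan ℝ A) : f.1 x = f.2 := by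
  have hle : affineSpan ℝ A ≤
      (AffineSubspace.mk' f.2 (⊥ : Submodule ℝ ℝ)).comap f.1.toLinearMap.toAffineMap := by
    rw [affineSpan_le]
    intro y hy
    simp [hA y hy]
  simpa [sub_eq_zero] using hle hx

/-- Inequalities for a face in its affine hull: those of `P` that are not equalities on it. -/
theorem Describes.describes_tight [DecidableEq (StrongDual ℝ E × ℝ)] (h : Describes s P)
    (t : Finset (StrongDual ℝ E × ℝ)) : Describes (s \ t) (tight P t) := by
  intro x
  refine ⟨fun hx => ⟨subset_affineSpan ℝ _ hx, fun f hf => h.le hx.1 (Finset.mem_sdiff.1 hf).1⟩, ?_⟩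
  rintro ⟨hx, hxs⟩
  have hxP : x ∈ affineSpan ℝ P := affineSpan_mono ℝ (fun y hy => hy.1) hx
  have hxt : ∀ f ∈ t, f.1 x = f.2 := fun f hf => eq_of_mem_affineSpan (fun y hy => hy.2 f hf) hx
  refine ⟨(h x).2 ⟨hxP, fun f hf => ?_⟩, hxt⟩
  by_cases hft : f ∈ t
  · exact (hxt f hft).le
  · exact hxs f (Finset.mem_sdiff.2 ⟨hf, hft⟩)

/-- For polyhedra, exposed faces of exposed faces are exposed. -/
theorem Describes.isExposed_trans (h : Describes s P) {F G : Set E} (hF : IsExposed ℝ P F)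
    (hG : IsExposed ℝ F G) : IsExposed ℝ P G := by
  classical
  intro hne
  obtain ⟨t, hts, rfl, -⟩ := h.exists_eq_tight hF (hne.mono hG.subset)
  obtain ⟨r, hrs, rfl, -⟩ := (h.describes_tight t).exists_eq_tight hG hne
  have : tight (tight P t) r = tight P (t ∪ r) := by
    ext x
    simp only [tight, Set.mem_ofPred_eq, Finset.mem_union, or_imp, forall_and,
      and_assoc]
  rw [this] at hne ⊢
  exact h.isExposed_tight (Finset.union_subset hts (hrs.trans Finset.sdiff_subset)) hne

theorem Describes.mem_vectorSpan_tight (h : Describes s P) {w y : E} (hw : w ∈ tight P t)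
    (hlt : ∀ f ∈ s, f ∉ t → f.1 w < f.2) (hy : y ∈ vectorSpan ℝ P) (hyt : ∀ f ∈ t, f.1 y = 0) :
    y ∈ vectorSpan ℝ (tight P t) := by
  obtain ⟨ε, hε, hmem⟩ := h.exists_add_smul_mem hw.1 hy (by
    intro f hf
    by_cases hft : f ∈ t
    · exact .inr (hyt f hft).le
    · exact .inl (hlt f hf hft))
  have hmem' : w + ε • y ∈ tight P t :=
    ⟨hmem, fun f hf => by simp [hyt f hf, hw.2 f hf]⟩
  have := vsub_mem_vectorSpan ℝ hmem' hw
  rw [vsub_eq_sub, add_sub_cancel_left] at this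
  exact (Submodule.smul_mem_iff _ hε.ne').1 this

/-- At least `d` inequalities are tight at a vertex of a `d`-polytope. -/
theorem Describes.exists_tight_vertex [FiniteDimensional ℝ E] (h : Describes s P) {d : ℕ}
    (hd : HasDim P d) {u : E} (hu : u ∈ vertices P) :
    ∃ t ⊆ s, d ≤ t.card ∧ ∀ f ∈ t, f.1 u = f.2 := by
  obtain ⟨t, hts, hut, w, hw, hlt⟩ := h.exists_eq_tight hu.1 hu.2.1
  obtain rfl : w = u := hw
  have hwt : w ∈ tight P t := hut ▸ rfl
  refine ⟨t, hts, ?_, hwt.2⟩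
  let φ : vectorSpan ℝ P →ₗ[ℝ] (t → ℝ) :=
    (LinearMap.pi fun f : t => f.1.1.toLinearMap) ∘ₗ (vectorSpan ℝ P).subtype
  have hφ : Function.Injective φ := by
    rw [← LinearMap.ker_eq_bot, LinearMap.ker_eq_bot']
    intro y hy
    have := h.mem_vectorSpan_tight hwt hlt y.2 fun f hf => congrFun hy ⟨f, hf⟩
    rw [← hut, vectorSpan_singleton] at this
    exact Subtype.ext this
  have := LinearMap.finrank_le_finrank_of_injective hφ
  rw [(hasDim_iff.1 hd).2] at this
  simpa using this

/-- A polytope of dimension `d ≥ 1` needs more than `d` inequalities: otherwise some direction in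
its affine hull violates none of them. -/
theorem Describes.lt_card [FiniteDimensional ℝ E] (h : Describes s P)
    (hb : Bornology.IsBounded P) {d : ℕ} (hd : HasDim P d) (hd0 : d ≠ 0) : d < s.card := by
  rw [hasDim_iff] at hd
  obtain ⟨⟨x, hx⟩, hd⟩ := hd
  by_contra! hle
  -- A direction that violates no inequality is zero.
  have hray : ∀ y ∈ vectorSpan ℝ P, (∀ f ∈ s, f.1 y ≤ 0) → y = 0 := by
    intro y hy hs
    by_contra hy0
    obtain ⟨R, hR⟩ := hb.exists_norm_le
    have hmem (r : ℝ) (hr : 0 ≤ r) : x + r • y ∈ P := by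
      refine (h _).2 ⟨?_, fun f hf => ?_⟩
      · rw [add_comm, ← vadd_eq_add]
        refine AffineSubspace.vadd_mem_of_mem_direction ?_ (subset_affineSpan ℝ P hx)
        rw [direction_affineSpan]
        exact Submodule.smul_mem _ _ hy
      · have := h.le hx hf
        have := hs f hf
        simp only [map_add, map_smul, smul_eq_mul]
        nlinarith
    have hypos : 0 < ‖y‖ := norm_pos_iff.2 hy0
    have hR0 : 0 ≤ R := (norm_nonneg x).trans (hR x hx)
    have h1 := hR _ (hmem ((2 * R + 1) / ‖y‖) (by positivity))
    have h2 : ‖((2 * R + 1) / ‖y‖) • y‖ = 2 * R + 1 := by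
      rw [norm_smul, Real.norm_of_nonneg (by positivity), div_mul_cancel₀ _ hypos.ne']
    have h3 := norm_sub_le (x + ((2 * R + 1) / ‖y‖) • y) x
    rw [add_sub_cancel_left, h2] at h3
    linarith [hR x hx]
  let φ : vectorSpan ℝ P →ₗ[ℝ] (s → ℝ) :=
    (LinearMap.pi fun f : s => f.1.1.toLinearMap) ∘ₗ (vectorSpan ℝ P).subtype
  have hφ : Function.Injective φ := by
    rw [← LinearMap.ker_eq_bot, LinearMap.ker_eq_bot']
    intro y hy
    exact Subtype.ext (hray y y.2 fun f hf => (congrFun hy ⟨f, hf⟩).le)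
  have hcard : s.card = d := by
    have := LinearMap.finrank_le_finrank_of_injective hφ
    rw [hd] at this
    exact le_antisymm hle (by simpa using this)
  have hsurj : Function.Surjective φ :=
    (LinearMap.injective_iff_surjective_of_finrank_eq_finrank (by simp [hd, hcard])).1 hφ
  obtain ⟨y, hy⟩ := hsurj fun _ => -1
  have hy' : ∀ f ∈ s, f.1 (y : E) = -1 := fun f hf => congrFun hy ⟨f, hf⟩
  have hy0 := hray y y.2 fun f hf => by rw [hy' f hf]; norm_num
  obtain ⟨f, hf⟩ : s.Nonempty := by
    rw [← Finset.card_pos]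
    omega
  have := hy' f hf
  rw [hy0, map_zero] at this
  norm_num at this

end Describes

/-! ### Facets and irredundant inequalities -/

section Facets

variable {E : Type*} [NormedAddCommGroup E] [NormedSpace ℝ E]
  {s t : Finset (StrongDual ℝ E × ℝ)} {P : Set E}

/-- Leaving out one inequality `f` of an irredundant description admits a point beyond the boundary
of `f`; the segment to it from a relatively interior point meets that boundary at a point where all
other inequalities are strict. -/
theorem IrredundantlyDescribes.exists_tight_singleton (h : IrredundantlyDescribes s P)
    (hne : P.Nonempty) {f : StrongDual ℝ E × ℝ} (hf : f ∈ s) :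
    (∃ w ∈ tight P {f}, ∀ g ∈ s, g ≠ f → g.1 w < g.2) ∧ ∃ y ∈ vectorSpan ℝ P, f.1 y ≠ 0 := by
  classical
  have hout : ∀ g ∈ s, ∃ z ∈ affineSpan ℝ P, (∀ g' ∈ s, g' ≠ g → g'.1 z ≤ g'.2) ∧ g.2 < g.1 z := by
    intro g hg
    have h' := h.2 _ (Finset.erase_ssubset hg)
    simp only [Describes, not_forall] at h'
    obtain ⟨z, hz⟩ := h'
    by_cases hzP : z ∈ P
    · exact absurd (iff_of_true hzP ⟨subset_affineSpan ℝ P hzP,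
        fun g' hg' => h.1.le hzP (Finset.mem_of_mem_erase hg')⟩) hz
    · have hz' := not_not.1 fun hn => hz (iff_of_false hzP hn)
      have hle : ∀ g' ∈ s, g' ≠ g → g'.1 z ≤ g'.2 :=
        fun g' hg' hne => hz'.2 g' (Finset.mem_erase.2 ⟨hne, hg'⟩)
      refine ⟨z, hz'.1, hle, ?_⟩
      by_contra! hgz
      refine hzP ((h.1 z).2 ⟨hz'.1, fun g' hg' => ?_⟩)
      by_cases hgg : g' = g
      · rwa [hgg]
      · exact hle g' hg' hgg
  obtain ⟨x, hx, hlt⟩ := exists_forall_lt h.1.convex hne (fun g hg x hx => h.1.le hx hg) (by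
    intro g hg
    by_contra! hge
    obtain ⟨z, hz, -, hgz⟩ := hout g hg
    exact hgz.ne' (eq_of_mem_affineSpan (fun y hy => (h.1.le hy hg).antisymm (hge y hy)) hz))
  obtain ⟨z, hz, hzle, hfz⟩ := hout f hf
  have hfx := hlt f hf
  have hxs := subset_affineSpan ℝ P hx
  have hdir : z - x ∈ vectorSpan ℝ P := by
    rw [← direction_affineSpan]
    exact AffineSubspace.vsub_mem_direction hz hxs
  refine ⟨?_, z - x, hdir, by rw [map_sub]; linarith⟩
  have hpos : 0 < f.1 z - f.1 x := by linarith
  obtain ⟨θ, hθ⟩ : ∃ θ, θ = (f.2 - f.1 x) / (f.1 z - f.1 x) := ⟨_, rfl⟩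
  have hθ0 : 0 < θ := hθ ▸ div_pos (by linarith) hpos
  have hθ1 : θ < 1 := by
    rw [hθ, div_lt_one hpos]
    linarith
  have hθf : θ * (f.1 z - f.1 x) = f.2 - f.1 x := by rw [hθ, div_mul_cancel₀ _ hpos.ne']
  have hwf : f.1 (x + θ • (z - x)) = f.2 := by
    simp only [map_add, map_smul, map_sub, smul_eq_mul]
    linarith
  have hwg : ∀ g ∈ s, g ≠ f → g.1 (x + θ • (z - x)) < g.2 := by
    intro g hg hgf
    have h1 := mul_pos (sub_pos.2 hθ1) (sub_pos.2 (hlt g hg))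
    have h2 := mul_nonneg hθ0.le (sub_nonneg.2 (hzle g hg hgf))
    simp only [map_add, map_smul, map_sub, smul_eq_mul]
    linarith
  refine ⟨x + θ • (z - x), ⟨(h.1 _).2 ⟨?_, fun g hg => ?_⟩, by simpa using hwf⟩, hwg⟩
  · rw [add_comm, ← vadd_eq_add]
    refine AffineSubspace.vadd_mem_of_mem_direction ?_ hxs
    rw [direction_affineSpan]
    exact Submodule.smul_mem _ _ hdir
  · by_cases hgf : g = f
    · exact hgf ▸ hwf.le
    · exact (hwg g hg hgf).le

theorem IrredundantlyDescribes.tight_mem_facets [FiniteDimensional ℝ E]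
    (h : IrredundantlyDescribes s P) {d : ℕ} (hd : HasDim P d) {f : StrongDual ℝ E × ℝ}
    (hf : f ∈ s) : tight P {f} ∈ facets P d := by
  obtain ⟨⟨w, hw, hlt⟩, y, hy, hfy⟩ := h.exists_tight_singleton hd.1 hf
  have hspan : vectorSpan ℝ (tight P {f}) =
      (LinearMap.ker (f.1.toLinearMap.domRestrict (vectorSpan ℝ P))).map
        (vectorSpan ℝ P).subtype := by
    apply le_antisymm
    · rw [vectorSpan_def, Submodule.span_le]
      rintro _ ⟨p, hp, q, hq, rfl⟩
      refine ⟨⟨_, vsub_mem_vectorSpan ℝ hp.1 hq.1⟩, ?_, rfl⟩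
      have h1 := hp.2 f (Finset.mem_singleton_self f)
      have h2 := hq.2 f (Finset.mem_singleton_self f)
      simp [h1, h2]
    · rintro _ ⟨x, hx, rfl⟩
      refine h.1.mem_vectorSpan_tight hw (fun g hg hgf => hlt g hg (by simpa using hgf)) x.2 ?_
      intro g hg
      rw [Finset.mem_singleton.1 hg]
      exact hx
  have hne : f.1.toLinearMap.domRestrict (vectorSpan ℝ P) ≠ 0 :=
    fun h0 => hfy (LinearMap.congr_fun h0 ⟨y, hy⟩)
  refine ⟨_, ?_, h.1.isExposed_tight (by simpa using hf), hasDim_iff.2 ⟨⟨w, hw⟩, rfl⟩⟩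
  rw [hspan, (Submodule.equivMapOfInjective _ (Submodule.subtype_injective _) _).symm.finrank_eq,
    ← (hasDim_iff.1 hd).2]
  exact Module.Dual.finrank_ker_add_one_of_ne_zero hne

theorem Describes.exists_eq_tight_of_mem_facets (h : Describes s P) {d : ℕ} (hd : HasDim P d)
    {F : Set E} (hF : F ∈ facets P d) : ∃ t ⊆ s, t.Nonempty ∧ F = tight P t := by
  obtain ⟨i, rfl, hF⟩ := hF
  obtain ⟨t, hts, rfl, -⟩ := h.exists_eq_tight hF.1 hF.2.1
  refine ⟨t, hts, Finset.nonempty_iff_ne_empty.2 ?_, rfl⟩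
  rintro rfl
  have : tight P ∅ = P := by simp [tight]
  rw [this] at hF
  have := hF.2.unique hd
  omega

/-- The facets of `P` correspond to the inequalities of an irredundant description. -/
theorem IrredundantlyDescribes.encard_facets [FiniteDimensional ℝ E]
    (h : IrredundantlyDescribes s P) {d : ℕ} (hd : HasDim P d) :
    (facets P d).encard = s.card := by
  have himage : facets P d = (fun f => tight P {f}) '' (s : Set (StrongDual ℝ E × ℝ)) := by
    ext F
    constructor
    · intro hF
      obtain ⟨t, hts, ⟨f, hf⟩, rfl⟩ := h.1.exists_eq_tight_of_mem_facets hd hF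
      refine ⟨f, hts hf, Eq.symm ?_⟩
      obtain ⟨i, rfl, hi⟩ := hF
      obtain ⟨j, hj, hj'⟩ := h.tight_mem_facets hd (hts hf)
      obtain rfl : j = i := by omega
      exact eq_of_isExposed_of_subset hi.1 hi.2 hj'.2
        (fun x hx => ⟨hx.1, fun g hg => hx.2 g (Finset.mem_singleton.1 hg ▸ hf)⟩) fun x hx => hx.1
    · rintro ⟨f, hf, rfl⟩
      exact h.tight_mem_facets hd hf
  rw [himage, Set.InjOn.encard_image, Set.encard_coe_eq_coe_finsetCard]
  intro f hf g hg hfg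
  by_contra hne
  obtain ⟨⟨w, hw, hlt⟩, -⟩ := h.exists_tight_singleton hd.1 hf
  have hw' : w ∈ tight P {g} := hfg.subset hw
  exact (hlt g hg (Ne.symm hne)).ne (hw'.2 g (Finset.mem_singleton_self g))

theorem IsPolyhedron.tight (hP : IsPolyhedron P) (t : Finset (StrongDual ℝ E × ℝ)) :
    IsPolyhedron (tight P t) := by
  classical
  obtain ⟨s, rfl⟩ := hP
  refine ⟨s ∪ (t ∪ t.image fun f => (-f.1, -f.2)), ?_⟩
  ext x
  simp only [PolytopeDiameter.tight, Set.mem_ofPred_eq, Finset.forall_mem_union,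
    Finset.forall_mem_image, neg_apply, neg_le_neg_iff, le_antisymm_iff, ← forall_and]

/-- The graph of a face is a subgraph of the graph of the polytope. -/
theorem Describes.edist_le_edist_face (h : Describes s P) {F : Set E} (hF : IsExposed ℝ P F)
    {u v : vertices P} (hu : (u : E) ∈ F) (hv : (v : E) ∈ F) :
    ∃ u' v' : vertices F, (graph P).edist u v ≤ (graph F).edist u' v' := by
  have hmem (w : vertices P) (hw : (w : E) ∈ F) : (w : E) ∈ vertices F :=
    ⟨w.2.1.mono hF.subset (Set.singleton_subset_iff.2 hw), w.2.2⟩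
  have hmem' (w : vertices F) : (w : E) ∈ vertices P := ⟨h.isExposed_trans hF w.2.1, w.2.2⟩
  refine ⟨⟨u, hmem u hu⟩, ⟨v, hmem v hv⟩, ?_⟩
  refine edist_map_le (G' := graph P) (fun w : vertices F => ⟨(w : E), hmem' w⟩) ?_
    (⟨u, hmem u hu⟩ : vertices F) ⟨v, hmem v hv⟩
  rintro w z ⟨hne, K, hK, hw, hz⟩
  exact .inr ⟨fun he => hne (Subtype.ext (congrArg (Subtype.val : vertices P → E) he)), K,
    ⟨h.isExposed_trans hF hK.1, hK.2⟩, hw, hz⟩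

end Facets

/-! ### The Klee–Walkup inequalities -/

/-- If there are fewer than `2 (d + 1)` facets, two vertices of a `(d + 1)`-polytope lie in a common
facet, which has itself fewer facets. -/
theorem H_succ_le {n d : ℕ} {b : ℕ∞} (hd0 : d ≠ 0) (hn : n < 2 * (d + 1))
    (hb : ∀ m, d < m → m < n → H m d ≤ b) : H n (d + 1) ≤ b := by
  classical
  refine H_le fun m P hP hd hcard u v => ?_
  obtain ⟨s₀, hs₀⟩ := hP.1.exists_describes
  obtain ⟨s, -, hs⟩ := hs₀.exists_irredundant
  have hsn : s.card = n := by
    rw [hs.encard_facets hd] at hcard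
    exact_mod_cast hcard
  obtain ⟨t, hts, htc, htu⟩ := hs.1.exists_tight_vertex hd u.2
  obtain ⟨r, hrs, hrc, hrv⟩ := hs.1.exists_tight_vertex hd v.2
  obtain ⟨f, hf⟩ : (t ∩ r).Nonempty := by
    rw [← Finset.card_pos]
    have := Finset.card_union_add_card_inter t r
    have := Finset.card_le_card (Finset.union_subset hts hrs)
    omega
  rw [Finset.mem_inter] at hf
  have hfs := hts hf.1
  have hF := mem_facets_succ.1 (hs.tight_mem_facets hd hfs)
  obtain ⟨s', hs', hF'⟩ := (hs.1.describes_tight {f}).exists_irredundant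
  have hPF : IsPolytope (tight P {f}) := ⟨hP.1.tight {f}, hP.2.subset fun x hx => hx.1⟩
  have hmem {w : vertices P} (hw : f.1 w = f.2) : (w : EuclideanSpace ℝ (Fin m)) ∈ tight P {f} :=
    ⟨w.2.1.subset rfl, by simpa using hw⟩
  obtain ⟨u', v', huv⟩ := hs.1.edist_le_edist_face hF.1 (hmem (htu f hf.1)) (hmem (hrv f hf.2))
  refine huv.trans ((edist_le_H hPF hF.2 (hF'.encard_facets hF.2) u' v').trans (hb _ ?_ ?_))
  · exact hF'.1.lt_card hPF.2 hF.2 hd0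
  · rw [← hsn]
    refine Finset.card_lt_card (hs'.trans_ssubset (Finset.sdiff_ssubset ?_ ⟨f, by simp⟩))
    simpa using hfs

theorem H_le_H_add {d k : ℕ} (hk : k ≠ 0) (j : ℕ) : H (d + k) d ≤ H (d + j + k) (d + j) := by
  induction j with
  | zero => exact le_rfl
  | succ j ih =>
    refine ih.trans ?_
    have := H_le_wedge (n := d + j + k) (d := d + j) (by omega)
    rwa [show d + j + k + 1 = d + (j + 1) + k by omega] at this

theorem H_le_of_le {d e k : ℕ} (hk : k ≠ 0) (hde : d ≤ e) : H (d + k) d ≤ H (e + k) e := by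
  obtain ⟨j, rfl⟩ := Nat.exists_eq_add_of_le hde
  exact H_le_H_add hk j

theorem H_two_mul_mono : Monotone fun k => H (2 * k) k :=
  monotone_nat_of_le_succ fun _ => H_le_prism

theorem H_le_H_two_mul {d k : ℕ} (hd : d ≠ 0) (hk : k ≠ 0) : H (d + k) d ≤ H (2 * k) k := by
  induction d generalizing k with
  | zero => exact absurd rfl hd
  | succ d ih =>
    rcases le_or_gt (d + 1) k with hdk | hdk
    · have := H_le_of_le hk hdk
      rwa [← two_mul] at this
    · refine H_succ_le (by omega) (by omega) fun m hm hmn => ?_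
      obtain ⟨j, rfl⟩ := Nat.exists_eq_add_of_lt hm
      have h1 : H (d + (j + 1)) d ≤ H (2 * (j + 1)) (j + 1) := ih (by omega) (by omega)
      exact h1.trans (H_two_mul_mono (by omega : j + 1 ≤ k))

end PolytopeDiameter

theorem theorem1p4 :
    (∀ d k : ℕ, 1 ≤ d → 1 ≤ k →
      PolytopeDiameter.H (d + k) d ≤ PolytopeDiameter.H (2 * k) k ∧
      (k < d → PolytopeDiameter.H (d + k) d = PolytopeDiameter.H (2 * k) k)) ∧
    ¬ (∀ d k : ℕ, 1 ≤ d → 1 ≤ k →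
      PolytopeDiameter.H (d + k) d = PolytopeDiameter.H (2 * k) k → k < d) := by
  -- For `d = k` both sides of the equality are literally the same.
  refine ⟨fun d k hd hk => ?_, fun h => lt_irrefl 1 (h 1 1 le_rfl le_rfl rfl)⟩
  have hle := PolytopeDiameter.H_le_H_two_mul (d := d) (k := k) (by omega) (by omega)
  refine ⟨hle, fun hkd => le_antisymm hle ?_⟩
  rw [two_mul]
  exact PolytopeDiameter.H_le_of_le (by omega) hkd.le
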